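/- **Model (synchronous idealized DAG protocol).** There are $n$ validators; a set of $h$ of them is honest, with honest fraction $H=h/n\in(1/2,1]$. Slots are $1,2,\dots$. In each slot each validator is eligible with probability $p\in(0,1]$, independently over slots and validators, and a validator can create at most one block per slot, only when eligible. The genesis block has slot $0$. Every block references older blocks (of strictly smaller slot); $a$ is an ancestor of $b$ if $b$ reaches $a$ along references. All honest parties have the same view at the end of each slot (initially only genesis; views only grow; with a block they contain all blocks it references; they contain no blocks of future slots). For a window length $w\ge 1$, a reference is short if it spans at most $w$ slots, and the tips at the end of slot $t$ are the visible blocks of slot $\ge t-w$ that no visible block of slot $\ge t-w$ short-references. An eligible honest validator creates a block that references all tips visible at the start of the slot (and possibly further visible blocks), and it is delivered to all honest parties by the end of the slot. Corrupted validators may behave arbitrarily otherwise: they choose whether to create a block, its references and when to reveal it, depending on all coins. Payloads never conflict. The preferred frontier $F_t$ consists of the tips that are not beaten by a conflicting tip in the fork-choice rule (hence of all tips, as there are no conflicts); $\mathrm{Past}_P(t)$ is the set of blocks that are in party $P$'s frontier $F_t$ or are ancestors of blocks in it; $\mathrm{Trim}(\mathrm{Past}_P(t),k)$ is the set of its blocks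 of slot $\le t-k$. The parameters $n,h,p,w$, and the lengths $\ell,T$ below, may depend on the security parameter $\kappa$. Let $\lambda_h=pHn$ be the expected number of honest blocks per slot. "With overwhelming probability" means: except with probability at most $\varepsilon(\kappa)$ for a negligible $\varepsilon$ that does not depend on the adversary or on the starting slot $t$. **Theorem.** 1. (DAG growth) There is $\tau_D=\tau_D(p,H)\in(0,1]$ with $\tau_D=\Theta(pH)$ (absolute constants) such that, whenever $w\lambda_h=\omega(\log\kappa)$, $\ell\lambda_h=\omega(\log\kappa)$ and $\ell$ is polynomially bounded, for every slot $t\ge1$, with overwhelming probability at least $\tau_D\,\ell$ honest blocks created in the slots $t,\dots,t+\ell-1$ lie in $\mathrm{Past}_P(t+\ell-1)$ for some honest $P$. 2. (DAG quality) For every constant $C$ there is $\mu_D=\mu_D(H)\in(0,1]$ with $\mu_D=\Theta(H)$ (constants depending only on $C$) such that, whenever $\ell\lambda_h=\omega(\log\kappa)$ and $w\le C\ell$ for all large $\kappa$, for every slot $t\ge1$, with overwhelming probability, for every honest party, at least a fraction $\mu_D$ of the blocks that enter its preferred frontier during the slots $t,\dots,t+\ell-1$ (that is, lie in $F_s\setminus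 F_{s-1}$ for such a slot $s$) was created by honest validators. 3. (DAG common past) There is an absolute constant $k_D$ such that, whenever $\lambda_h=\omega(\log\kappa)$ and $T$ is polynomially bounded, for every $t$, with overwhelming probability $$\mathrm{Trim}(\mathrm{Past}_P(t_1),k_D)\subseteq \mathrm{Trim}(\mathrm{Past}_Q(t_2),k_D)$$ for all honest parties $P,Q$ and all times $t\le t_1\le t_2\le t+T$. -/

import Mathlib

open Filter MeasureTheory ProbabilityTheory Asymptotics

universe u

namespace AreonIdeal

/-! ### Blocks and executions -/

/-- Blocks of an execution with `n` validators. In the idealized protocol a validator produces at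
most one block per slot, so a non-genesis block is identified by its slot and its validator. -/
inductive Block (n : ℕ) : Type
  | genesis : Block n
  | mk (slot : ℕ) (validator : Fin n) : Block n

/-- The slot of a block; genesis has slot `0`, all other blocks have slots `≥ 1` (see
`Execution.Valid`). -/
def Block.slot {n : ℕ} : Block n → ℕ
  | .genesis => 0
  | .mk s _ => s

/-- `b` was created by a validator of `honest`. -/
def Block.IsHonest {n : ℕ} (honest : Finset (Fin n)) : Block n → Prop
  | .genesis => False
  | .mk _ v => v ∈ honest

/-- The data of one execution: the references of the blocks, the public-coin labels used for
tie-breaking, the application-level conflict relation of payloads, and the view `view P t` of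
party `P` at the end of slot `t`. -/
structure Execution (n : ℕ) where
  refs : Block n → Finset (Block n)
  label : Block n → ℕ
  conflicts : Block n → Block n → Prop
  view : Fin n → ℕ → Finset (Block n)

namespace Execution

variable {n : ℕ} (E : Execution n)

/-! ### Ancestry -/

/-- The edge `a → b` (that is, `b` references `a`) of the subgraph induced on the view `V`. -/
def Edge (V : Finset (Block n)) (a b : Block n) : Prop :=
  a ∈ V ∧ b ∈ V ∧ a ∈ E.refs b

/-- `a` is an ancestor of `b` in the view `V`. -/
def IsAnc (V : Finset (Block n)) (a b : Block n) : Prop :=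
  Relation.TransGen (E.Edge V) a b

/-- `a` is an ancestor of `b` in the view `V`, or `a = b`. -/
def IsAncStar (V : Finset (Block n)) (a b : Block n) : Prop :=
  Relation.ReflTransGen (E.Edge V) a b

/-! ### Short references and tips -/

/-- The short references of a block: those to blocks at most `w` slots older. -/
def shortRefs (w : ℕ) (d : Block n) : Finset (Block n) :=
  (E.refs d).filter fun r => r.slot + 1 ≤ d.slot ∧ d.slot ≤ r.slot + w

/-- The window `V_w(t)` of the view of `P` at the end of slot `t`: the blocks of slot `≥ t - w`. -/
def window (w : ℕ) (P : Fin n) (t : ℕ) : Set (Block n) :=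
  {b | b ∈ E.view P t ∧ t ≤ b.slot + w}

/-- The short-reference tips of the view of `P` at the end of slot `t`: the blocks of the window
that no block of the window short-references. -/
def tips (w : ℕ) (P : Fin n) (t : ℕ) : Set (Block n) :=
  {b | b ∈ E.window w P t ∧ ¬ ∃ d ∈ E.window w P t, b ∈ E.shortRefs w d}

/-! ### Fork choice -/

/-- `c` is a closest common ancestor of `i` and `j`: a common ancestor that maximizes
`(slot, label)` lexicographically. -/
def IsCCA (V : Finset (Block n)) (i j c : Block n) : Prop :=
  (E.IsAnc V c i ∧ E.IsAnc V c j) ∧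
    ∀ c', E.IsAnc V c' i → E.IsAnc V c' j →
      toLex (c'.slot, E.label c') ≤ toLex (c.slot, E.label c)

open Classical in
/-- The subDAG weight of `i` relative to `c`: the number of short references made by the common
descendants of `i` and `c` (both included). -/
noncomputable def subdagWeight (w : ℕ) (V : Finset (Block n)) (i c : Block n) : ℕ :=
  ∑ d ∈ V.filter (fun d => E.IsAncStar V i d ∧ E.IsAncStar V c d), (E.shortRefs w d).card

/-- Conflicted-tips resolution selects `x` against `x'`: larger subDAG weight relative to the
closest common ancestor, ties broken by the larger label. -/
def Beats (w : ℕ) (V : Finset (Block n)) (x x' : Block n) : Prop :=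
  ∃ c, E.IsCCA V x x' c ∧
    (E.subdagWeight w V x' c < E.subdagWeight w V x c ∨
      (E.subdagWeight w V x' c = E.subdagWeight w V x c ∧ E.label x' < E.label x))

/-- The preferred frontier `F_t` of `P`: the tips that are not beaten by a conflicting tip. -/
def frontier (w : ℕ) (P : Fin n) (t : ℕ) : Set (Block n) :=
  {x | x ∈ E.tips w P t ∧
    ¬ ∃ x' ∈ E.tips w P t, E.conflicts x' x ∧ E.Beats w (E.view P t) x' x}

/-- `Past_P(t)`: the preferred frontier of `P` at the end of slot `t` and all its ancestors. -/
def past (w : ℕ) (P : Fin n) (t : ℕ) : Set (Block n) :=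
  {b | ∃ x ∈ E.frontier w P t, E.IsAncStar (E.view P t) b x}

/-- `Trim(Past_P(t), k)`: the past without the blocks of the `k` most recent slots
`t - k + 1, …, t`. -/
def trimmedPast (w k : ℕ) (P : Fin n) (t : ℕ) : Set (Block n) :=
  {b | b ∈ E.past w P t ∧ b.slot + k ≤ t}

/-! ### The synchronous idealized protocol -/

/-- `E` is an execution of the synchronous idealized protocol with window `w`, honest validators
`honest` and eligibility outcomes `elig (s, v)`. Nothing beyond these rules constrains the
corrupted validators: when eligible they may or may not create a block, with any references to
older blocks, and may reveal it in any later slot. -/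
structure Valid (w : ℕ) (honest : Finset (Fin n)) (elig : ℕ × Fin n → Bool) : Prop where
  /-- There are no conflicts between payloads. -/
  noConflict : ∀ b b', ¬ E.conflicts b b'
  /-- Everybody starts from genesis. -/
  view_zero : ∀ P ∈ honest, E.view P 0 = {Block.genesis}
  /-- Views only grow. -/
  view_mono : ∀ P ∈ honest, ∀ t, E.view P t ⊆ E.view P (t + 1)
  /-- Synchrony (honest parties relay what they accept): a block in an honest view at the end of
  slot `t` is in every honest view at the end of slot `t`. -/
  sync : ∀ P ∈ honest, ∀ Q ∈ honest, ∀ t, E.view P t ⊆ E.view Q t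
  /-- Only blocks of eligible validators, of the present or an earlier slot, are accepted. -/
  eligible : ∀ P ∈ honest, ∀ t s v, Block.mk s v ∈ E.view P t →
    1 ≤ s ∧ s ≤ t ∧ elig (s, v) = true
  /-- References of accepted blocks are known and point strictly backward in slot. -/
  refs_valid : ∀ P ∈ honest, ∀ t, ∀ b ∈ E.view P t, ∀ r ∈ E.refs b,
    r ∈ E.view P t ∧ r.slot < b.slot
  /-- An eligible honest validator creates a block and broadcasts it in the same slot. -/
  honest_creates : ∀ v ∈ honest, ∀ s, elig (s + 1, v) = true →
    Block.mk (s + 1) v ∈ E.view v (s + 1)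
  /-- Unbounded referencing: an honest block may reference any blocks visible at the start of the
  slot, and it references all tips that are visible then. -/
  honest_refs : ∀ v ∈ honest, ∀ s, elig (s + 1, v) = true →
    E.tips w v s ⊆ ↑(E.refs (Block.mk (s + 1) v)) ∧
      E.refs (Block.mk (s + 1) v) ⊆ E.view v s

/-! ### The sets that growth and quality count -/

/-- The honest blocks created in the slots `t, …, t + ℓ - 1` that at the end of slot `t + ℓ - 1`
lie in the past of the preferred frontier of some honest party. -/
def grown (w : ℕ) (honest : Finset (Fin n)) (t ℓ : ℕ) : Set (Block n) :=
  {b | b.IsHonest honest ∧ t ≤ b.slot ∧ b.slot < t + ℓ ∧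
    ∃ P ∈ honest, b ∈ E.past w P (t + ℓ - 1)}

/-- The blocks that enter the preferred frontier of `P` during the slots `t, …, t + ℓ - 1`
(for `t ≥ 1`). -/
def entering (w : ℕ) (P : Fin n) (t ℓ : ℕ) : Set (Block n) :=
  {b | ∃ s, t ≤ s ∧ s < t + ℓ ∧ b ∈ E.frontier w P s ∧ b ∉ E.frontier w P (s - 1)}

end Execution

/-! ### Parameters, probability and the consensus properties -/

/-- Parameters of the idealized protocol. -/
structure Params where
  /-- number of validators -/
  n : ℕ
  /-- the honest validators -/
  honest : Finset (Fin n)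
  /-- probability that a given validator is eligible in a given slot -/
  p : ℝ
  /-- length of the short-reference window -/
  w : ℕ
  p_pos : 0 < p
  p_le_one : p ≤ 1
  w_pos : 1 ≤ w
  honest_majority : (1 : ℝ) / 2 < (honest.card : ℝ) / n

/-- The honest fraction `H` of the validators. -/
noncomputable def Params.H (par : Params) : ℝ := (par.honest.card : ℝ) / par.n

/-- The expected number `p H n` of honest blocks per slot. -/
noncomputable def Params.honestRate (par : Params) : ℝ := par.p * par.honest.card

/-- Public-coin eligibility: independent coins for all slots and validators, each of which is
`true` with probability `p`. -/
structure PublicCoin {Ω : Type u} [MeasurableSpace Ω] (Pr : Measure Ω) {n : ℕ} (p : ℝ)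
    (coin : ℕ × Fin n → Ω → Bool) : Prop where
  measurable : ∀ i, Measurable (coin i)
  indep : iIndepFun coin Pr
  prob : ∀ i, Pr {ω | coin i ω = true} = ENNReal.ofReal p

/-- `f = ω(log κ)`. -/
def SuperLog (f : ℕ → ℝ) : Prop :=
  (fun κ : ℕ => Real.log κ) =o[atTop] f

/-- `f` is polynomially bounded. -/
def PolyBounded (f : ℕ → ℕ) : Prop :=
  ∃ d : ℕ, (fun κ : ℕ => (f κ : ℝ)) =O[atTop] fun κ : ℕ => (κ : ℝ) ^ d

/-- Negligible functions of the security parameter. -/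
def Negligible (ε : ℕ → ℝ) : Prop :=
  SuperpolynomialDecay atTop (fun κ : ℕ => (κ : ℝ)) ε

/-- The property `good κ t`, about the execution from slot `t` on, fails with probability at most
`ε κ` for a negligible function `ε` that depends neither on `t` nor on the adversary. The execution
`E ω` may depend on the sample point in any way that respects the protocol, so that the corrupted
validators may be randomized and may adapt to all coins. No measurability of `E` is required; the
(outer) measure of the event of failure is bounded. -/
def WithOverwhelmingProb (par : ℕ → Params)
    (good : (κ : ℕ) → ℕ → Execution (par κ).n → Prop) : Prop :=
  ∃ ε : ℕ → ℝ, Negligible ε ∧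
    ∀ (κ t : ℕ) (Ω : Type u) [MeasurableSpace Ω] (Pr : Measure Ω) [IsProbabilityMeasure Pr]
      (coin : ℕ × Fin (par κ).n → Ω → Bool) (E : Ω → Execution (par κ).n),
      PublicCoin Pr (par κ).p coin →
      (∀ ω, (E ω).Valid (par κ).w (par κ).honest (fun i => coin i ω)) →
      Pr {ω | ¬ good κ t (E ω)} ≤ ENNReal.ofReal (ε κ)

/-- DAG growth `DG[τ, ℓ]`: in every interval of `ℓ` slots, at least `τ ℓ` honest blocks are created
and lie in the past of an honest preferred frontier by the end of the interval. -/
def DAGGrowth (par : ℕ → Params) (τ : ℕ → ℝ) (ℓ : ℕ → ℕ) : Prop :=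
  WithOverwhelmingProb.{u} par fun κ t E =>
    1 ≤ t → τ κ * ℓ κ ≤ ((E.grown (par κ).w (par κ).honest t (ℓ κ)).ncard : ℝ)

/-- DAG quality `DQ[μ, ℓ]`: in every interval of `ℓ` slots and for every honest party, at least a
fraction `μ` of the blocks that enter the preferred frontier is honest. -/
def DAGQuality (par : ℕ → Params) (μ : ℕ → ℝ) (ℓ : ℕ → ℕ) : Prop :=
  WithOverwhelmingProb.{u} par fun κ t E =>
    1 ≤ t → ∀ P ∈ (par κ).honest,
      μ κ * ((E.entering (par κ).w P t (ℓ κ)).ncard : ℝ) ≤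
        (({b ∈ E.entering (par κ).w P t (ℓ κ) | b.IsHonest (par κ).honest}).ncard : ℝ)

/-- DAG common past with parameter `k` over stretches of `T` slots: for all honest `P`, `Q` and all
times `t₁ ≤ t₂` of the stretch, the trimmed past of `P` at time `t₁` is contained in that of `Q` at
time `t₂`. -/
def DAGCommonPast (par : ℕ → Params) (k : ℕ) (T : ℕ → ℕ) : Prop :=
  WithOverwhelmingProb.{u} par fun κ t E =>
    ∀ P ∈ (par κ).honest, ∀ Q ∈ (par κ).honest, ∀ t₁ t₂ : ℕ,
      t ≤ t₁ → t₁ ≤ t₂ → t₂ ≤ t + T κ →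
        E.trimmedPast (par κ).w k P t₁ ⊆ E.trimmedPast (par κ).w k Q t₂

end AreonIdeal

/-!
Without payload conflicts the preferred frontier consists of all tips, and every block of the window
is a tip or an ancestor of one. An honest block references all tips of the previous slot, so it
inherits the whole past of that slot and keeps it in the past for the next `w` slots, for as long
as it stays in the window. Consequently a block in an honest view remains in the past as long as
every `w` consecutive slots contain an honest block, which gives growth, and the past is monotone
over slots that each contain an honest block, which gives common past for every trimming parameter.
For quality, every honest block enters the frontier when it is created, while every block entering
during `ℓ` slots is genesis or one of the at most `2 p n (ℓ + w)` blocks of the last `ℓ + w` slots.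
What remains are Chernoff bounds for the coins and a union bound over the starting slots of a
stretch without honest blocks.
-/

namespace AreonIdeal

section Counting

variable {ι : Type*}

/-- The number of coins of `S` that show `true` in the outcome `x`. -/
def trueCount (S : Finset ι) (x : ι → Bool) : ℕ :=
  (S.filter fun i => x i = true).card

theorem trueCount_le_card (S : Finset ι) (x : ι → Bool) : trueCount S x ≤ S.card :=
  Finset.card_filter_le _ _

theorem trueCount_eq_zero_iff {S : Finset ι} {x : ι → Bool} :
    trueCount S x = 0 ↔ ∀ i ∈ S, ¬ x i = true := by
  rw [trueCount, Finset.card_eq_zero, Finset.filter_eq_empty_iff]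

theorem cast_trueCount (S : Finset ι) (x : ι → Bool) :
    (trueCount S x : ℝ) = ∑ i ∈ S, if x i = true then (1 : ℝ) else 0 := by
  simp [trueCount]

end Counting

/-! ### Chernoff bounds for independent coins -/

section Chernoff

variable {ι Ω : Type*} [MeasurableSpace Ω] {Pr : Measure Ω}

/-- The expected number of coins of `S` that show `true`, as the sum of their probabilities of doing
so. -/
noncomputable def expectedTrueCount (Pr : Measure Ω) (X : ι → Ω → Bool) (S : Finset ι) : ℝ :=
  ∑ i ∈ S, Pr.real {ω | X i ω = true}

theorem expectedTrueCount_nonneg (X : ι → Ω → Bool) (S : Finset ι) :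
    0 ≤ expectedTrueCount Pr X S :=
  Finset.sum_nonneg fun _ _ => measureReal_nonneg

theorem measurable_ite_eq_true {Y : Ω → Bool} (hY : Measurable Y) :
    Measurable fun ω => if Y ω = true then (1 : ℝ) else 0 :=
  Measurable.ite (hY (measurableSet_singleton true)) measurable_const measurable_const

theorem measurable_trueCount {X : ι → Ω → Bool} (hX : ∀ i, Measurable (X i)) (S : Finset ι) :
    Measurable fun ω => (trueCount S (X · ω) : ℝ) := by
  simp only [cast_trueCount]
  exact Finset.measurable_sum _ fun i _ => measurable_ite_eq_true (hX i)

variable [IsProbabilityMeasure Pr]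

theorem mgf_ite_eq_true {Y : Ω → Bool} (hY : Measurable Y) (c : ℝ) :
    mgf (fun ω => if Y ω = true then (1 : ℝ) else 0) Pr c =
      1 + Pr.real {ω | Y ω = true} * (Real.exp c - 1) := by
  have hS : MeasurableSet {ω | Y ω = true} := hY (measurableSet_singleton true)
  have hexp : (fun ω => Real.exp (c * if Y ω = true then (1 : ℝ) else 0)) =
      fun ω => 1 + {ω | Y ω = true}.indicator (fun _ => Real.exp c - 1) ω := by
    funext ω
    by_cases h : Y ω = true <;> simp [h]
  rw [mgf, hexp, integral_add (integrable_const _) ((integrable_const _).indicator hS),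
    integral_indicator_const _ hS]
  simp

theorem mgf_trueCount_le {X : ι → Ω → Bool} (hX : ∀ i, Measurable (X i)) (hind : iIndepFun X Pr)
    (S : Finset ι) (c : ℝ) :
    mgf (fun ω => (trueCount S (X · ω) : ℝ)) Pr c ≤
      Real.exp (expectedTrueCount Pr X S * (Real.exp c - 1)) := by
  have hindicator : iIndepFun (fun i ω => if X i ω = true then (1 : ℝ) else 0) Pr :=
    hind.comp (fun _ b => if b = true then (1 : ℝ) else 0) fun _ => measurable_of_finite _
  have hsum : (fun ω => (trueCount S (X · ω) : ℝ)) =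
      ∑ i ∈ S, fun ω => if X i ω = true then (1 : ℝ) else 0 := by
    funext ω
    rw [cast_trueCount, Finset.sum_apply]
  rw [hsum, hindicator.mgf_sum (fun i => measurable_ite_eq_true (hX i)), expectedTrueCount,
    Finset.sum_mul, Real.exp_sum]
  refine Finset.prod_le_prod (fun _ _ => mgf_nonneg) fun i _ => ?_
  rw [mgf_ite_eq_true (hX i), add_comm]
  exact Real.add_one_le_exp _

theorem integrable_exp_mul_trueCount {X : ι → Ω → Bool} (hX : ∀ i, Measurable (X i))
    (S : Finset ι) (c : ℝ) :
    Integrable (fun ω => Real.exp (c * (trueCount S (X · ω) : ℝ))) Pr :=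
  integrable_exp_mul_of_mem_Icc (a := 0) (b := S.card) (measurable_trueCount hX S).aemeasurable
    (ae_of_all _ fun _ => ⟨Nat.cast_nonneg _, Nat.cast_le.2 (trueCount_le_card _ _)⟩)

theorem measureReal_trueCount_le_half {X : ι → Ω → Bool} (hX : ∀ i, Measurable (X i))
    (hind : iIndepFun X Pr) (S : Finset ι) :
    Pr.real {ω | (trueCount S (X · ω) : ℝ) ≤ expectedTrueCount Pr X S / 2} ≤
      Real.exp (-(expectedTrueCount Pr X S / 8)) := by
  set m := expectedTrueCount Pr X S
  have hm : 0 ≤ m := expectedTrueCount_nonneg X S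
  calc Pr.real {ω | (trueCount S (X · ω) : ℝ) ≤ m / 2}
      ≤ Real.exp (-(-1) * (m / 2)) * mgf (fun ω => (trueCount S (X · ω) : ℝ)) Pr (-1) :=
        measure_le_le_exp_mul_mgf _ (by norm_num) (integrable_exp_mul_trueCount hX S _)
    _ ≤ Real.exp (-(-1) * (m / 2)) * Real.exp (m * (Real.exp (-1) - 1)) := by
        gcongr
        exact mgf_trueCount_le hX hind S _
    _ ≤ Real.exp (-(m / 8)) := by
        rw [← Real.exp_add, Real.exp_le_exp]
        nlinarith [Real.exp_neg_one_lt_d9]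

theorem measureReal_two_mul_le_trueCount {X : ι → Ω → Bool} (hX : ∀ i, Measurable (X i))
    (hind : iIndepFun X Pr) (S : Finset ι) {M : ℝ} (hM : expectedTrueCount Pr X S ≤ M) :
    Pr.real {ω | 2 * M ≤ (trueCount S (X · ω) : ℝ)} ≤ Real.exp (-(M / 4)) := by
  set m := expectedTrueCount Pr X S
  have hm : 0 ≤ m := expectedTrueCount_nonneg X S
  calc Pr.real {ω | 2 * M ≤ (trueCount S (X · ω) : ℝ)}
      ≤ Real.exp (-1 * (2 * M)) * mgf (fun ω => (trueCount S (X · ω) : ℝ)) Pr 1 :=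
        measure_ge_le_exp_mul_mgf _ (by norm_num) (integrable_exp_mul_trueCount hX S _)
    _ ≤ Real.exp (-1 * (2 * M)) * Real.exp (m * (Real.exp 1 - 1)) := by
        gcongr
        exact mgf_trueCount_le hX hind S _
    _ ≤ Real.exp (-(M / 4)) := by
        rw [← Real.exp_add, Real.exp_le_exp]
        nlinarith [Real.exp_one_lt_d9, Real.add_one_le_exp (1 : ℝ)]

end Chernoff

/-- Some validator of `A` is eligible in one of the `m` slots `r, …, r + m - 1`. -/
def EligibleWithin {n : ℕ} (elig : ℕ × Fin n → Bool) (A : Finset (Fin n)) (r m : ℕ) : Prop :=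
  ∃ s ∈ Finset.Ico r (r + m), ∃ v ∈ A, elig (s, v) = true

theorem trueCount_eq_zero_of_not_eligibleWithin {n : ℕ} {elig : ℕ × Fin n → Bool}
    {A : Finset (Fin n)} {r m : ℕ} (h : ¬ EligibleWithin elig A r m) :
    trueCount (Finset.Ico r (r + m) ×ˢ A) elig = 0 :=
  trueCount_eq_zero_iff.2 fun i hi hel =>
    h ⟨i.1, (Finset.mem_product.1 hi).1, i.2, (Finset.mem_product.1 hi).2, hel⟩

namespace PublicCoin

variable {Ω : Type u} [MeasurableSpace Ω] {Pr : Measure Ω} {n : ℕ} {p : ℝ}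
  {coin : ℕ × Fin n → Ω → Bool}

theorem expectedTrueCount_eq (hc : PublicCoin Pr p coin) (hp : 0 ≤ p) (S : Finset (ℕ × Fin n)) :
    expectedTrueCount Pr coin S = p * S.card := by
  simp only [expectedTrueCount, measureReal_def, hc.prob, ENNReal.toReal_ofReal hp,
    Finset.sum_const, nsmul_eq_mul, mul_comm]

theorem expectedTrueCount_Ico_product (hc : PublicCoin Pr p coin) (hp : 0 ≤ p) (r m : ℕ)
    (A : Finset (Fin n)) :
    expectedTrueCount Pr coin (Finset.Ico r (r + m) ×ˢ A) = m * (p * A.card) := by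
  rw [hc.expectedTrueCount_eq hp, Finset.card_product, Nat.card_Ico, add_tsub_cancel_left]
  push_cast
  ring

variable [IsProbabilityMeasure Pr]

theorem measureReal_trueCount_Ico_le_half (hc : PublicCoin Pr p coin) (hp : 0 ≤ p) (r m : ℕ)
    (A : Finset (Fin n)) :
    Pr.real {ω | (trueCount (Finset.Ico r (r + m) ×ˢ A) (coin · ω) : ℝ) ≤ m * (p * A.card) / 2} ≤
      Real.exp (-(m * (p * A.card) / 8)) := by
  rw [← hc.expectedTrueCount_Ico_product hp r]
  exact measureReal_trueCount_le_half hc.measurable hc.indep _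

theorem measureReal_exists_not_eligibleWithin_le (hc : PublicCoin Pr p coin) (hp : 0 ≤ p)
    (A : Finset (Fin n)) (R : Finset ℕ) (m : ℕ) :
    Pr.real {ω | ∃ r ∈ R, ¬ EligibleWithin (coin · ω) A r m} ≤
      R.card * Real.exp (-(m * (p * A.card) / 8)) := by
  have hfew : {ω | ∃ r ∈ R, ¬ EligibleWithin (coin · ω) A r m} ⊆ ⋃ r ∈ R,
      {ω | (trueCount (Finset.Ico r (r + m) ×ˢ A) (coin · ω) : ℝ) ≤ m * (p * A.card) / 2} := by
    rintro ω ⟨r, hr, hgap⟩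
    refine Set.mem_biUnion hr ?_
    rw [Set.mem_ofPred_eq, trueCount_eq_zero_of_not_eligibleWithin hgap, Nat.cast_zero]
    positivity
  calc Pr.real {ω | ∃ r ∈ R, ¬ EligibleWithin (coin · ω) A r m}
      ≤ ∑ r ∈ R, Pr.real {ω | (trueCount (Finset.Ico r (r + m) ×ˢ A) (coin · ω) : ℝ) ≤
          m * (p * A.card) / 2} :=
        (measureReal_mono hfew (measure_ne_top _ _)).trans (measureReal_biUnion_finset_le _ _)
    _ ≤ R.card * Real.exp (-(m * (p * A.card) / 8)) :=
        (Finset.sum_le_card_nsmul _ _ _ fun r _ =>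
          hc.measureReal_trueCount_Ico_le_half hp r m A).trans_eq (nsmul_eq_mul _ _)

end PublicCoin

/-! ### The past in a valid execution -/

namespace Execution

variable {n : ℕ} {E : Execution n}

theorem IsAncStar.mono {V W : Finset (Block n)} (h : V ⊆ W) {a b : Block n}
    (hab : E.IsAncStar V a b) : E.IsAncStar W a b :=
  Relation.ReflTransGen.mono (fun _ _ hxy => ⟨h hxy.1, h hxy.2.1, hxy.2.2⟩) _ _ hab

namespace Valid

variable {w : ℕ} {honest : Finset (Fin n)} {elig : ℕ × Fin n → Bool}

theorem view_eq (hE : E.Valid w honest elig) {P Q : Fin n} (hP : P ∈ honest) (hQ : Q ∈ honest)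
    (t : ℕ) : E.view P t = E.view Q t :=
  (hE.sync P hP Q hQ t).antisymm (hE.sync Q hQ P hP t)

theorem monotone_view (hE : E.Valid w honest elig) {P : Fin n} (hP : P ∈ honest) :
    Monotone (E.view P) :=
  monotone_nat_of_le_succ (hE.view_mono P hP)

theorem slot_le (hE : E.Valid w honest elig) {P : Fin n} (hP : P ∈ honest) {t : ℕ} {b : Block n}
    (hb : b ∈ E.view P t) : b.slot ≤ t := by
  cases b with
  | genesis => exact Nat.zero_le t
  | mk s v => exact (hE.eligible P hP t s v hb).2.1

theorem tips_eq (hE : E.Valid w honest elig) {P Q : Fin n} (hP : P ∈ honest) (hQ : Q ∈ honest)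
    (t : ℕ) : E.tips w P t = E.tips w Q t := by
  simp only [tips, window, hE.view_eq hP hQ t]

theorem frontier_eq_tips (hE : E.Valid w honest elig) (P : Fin n) (t : ℕ) :
    E.frontier w P t = E.tips w P t :=
  Set.ext fun _ => ⟨fun h => h.1, fun h => ⟨h, fun ⟨_, _, hc, _⟩ => hE.noConflict _ _ hc⟩⟩

theorem past_eq (hE : E.Valid w honest elig) {P Q : Fin n} (hP : P ∈ honest) (hQ : Q ∈ honest)
    (t : ℕ) : E.past w P t = E.past w Q t := by
  simp only [past, hE.frontier_eq_tips, hE.tips_eq hP hQ t, hE.view_eq hP hQ t]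

theorem window_subset_past (hE : E.Valid w honest elig) {P : Fin n} (hP : P ∈ honest) (t : ℕ) :
    E.window w P t ⊆ E.past w P t := by
  intro b hb
  induction hage : t - b.slot using Nat.strong_induction_on generalizing b with
  | _ age ih =>
    by_cases hd : ∃ d ∈ E.window w P t, b ∈ E.shortRefs w d
    · obtain ⟨d, hdw, hbd⟩ := hd
      simp only [shortRefs, Finset.mem_filter] at hbd
      have hdt := hE.slot_le hP hdw.1
      obtain ⟨x, hx, hdx⟩ := ih (t - d.slot) (by omega) hdw rfl
      exact ⟨x, hx, hdx.head ⟨hb.1, hdw.1, hbd.1⟩⟩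
    · exact ⟨b, (hE.frontier_eq_tips P t).symm ▸ ⟨hb, hd⟩, .refl⟩

theorem mem_past_of_isAncStar (hE : E.Valid w honest elig) {P : Fin n} (hP : P ∈ honest)
    {s t : ℕ} (hst : s ≤ t) {b d : Block n} (hbd : E.IsAncStar (E.view P s) b d)
    (hd : d ∈ E.window w P t) : b ∈ E.past w P t := by
  obtain ⟨x, hx, hdx⟩ := hE.window_subset_past hP t hd
  exact ⟨x, hx, (hbd.mono (hE.monotone_view hP hst)).trans hdx⟩

theorem honest_mem_view (hE : E.Valid w honest elig) {P v : Fin n} (hP : P ∈ honest)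
    (hv : v ∈ honest) {s t : ℕ} (hs : 1 ≤ s) (hst : s ≤ t) (hel : elig (s, v) = true) :
    Block.mk s v ∈ E.view P t := by
  obtain ⟨s, rfl⟩ := Nat.exists_eq_add_of_le' hs
  exact hE.monotone_view hP hst (hE.sync v hv P hP _ (hE.honest_creates v hv s hel))

theorem isAncStar_honest_of_mem_past (hE : E.Valid w honest elig) {P v : Fin n} (hP : P ∈ honest)
    (hv : v ∈ honest) {s : ℕ} (hel : elig (s + 1, v) = true) {b : Block n}
    (hb : b ∈ E.past w P s) : E.IsAncStar (E.view P (s + 1)) b (Block.mk (s + 1) v) := by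
  obtain ⟨x, hx, hbx⟩ := hb
  rw [hE.frontier_eq_tips] at hx
  have hview := hE.view_mono P hP s
  refine (hbx.mono hview).tail ⟨hview hx.1.1, hE.honest_mem_view hP hv (by omega) le_rfl hel, ?_⟩
  rw [hE.tips_eq hP hv] at hx
  exact (hE.honest_refs v hv s hel).1 hx

theorem past_subset_past_of_honest (hE : E.Valid w honest elig) {P v : Fin n} (hP : P ∈ honest)
    (hv : v ∈ honest) {s t : ℕ} (hel : elig (s + 1, v) = true) (hst : s + 1 ≤ t)
    (htw : t ≤ s + 1 + w) : E.past w P s ⊆ E.past w P t := fun _ hb =>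
  hE.mem_past_of_isAncStar hP hst (hE.isAncStar_honest_of_mem_past hP hv hel hb)
    ⟨hE.honest_mem_view hP hv (by omega) hst hel, htw⟩

theorem mem_past_of_forall_eligibleWithin (hE : E.Valid w honest elig) {P : Fin n}
    (hP : P ∈ honest) {b : Block n} (hb : b ∈ E.view P b.slot) {e : ℕ} (hbe : b.slot ≤ e)
    (hdense : ∀ r ∈ Finset.Ioc b.slot e, EligibleWithin elig honest r w) :
    b ∈ E.past w P e := by
  induction e using Nat.strong_induction_on with
  | _ e ih =>
    rcases Nat.lt_or_ge (b.slot + w) e with hold | hrecent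
    · obtain ⟨s, hs, v, hv, hel⟩ := hdense (e - (w - 1)) (Finset.mem_Ioc.2 (by omega))
      rw [Finset.mem_Ico] at hs
      obtain ⟨s, rfl⟩ := Nat.exists_eq_add_of_le' (show 1 ≤ s by omega)
      refine hE.past_subset_past_of_honest hP hv hel (by omega) (by omega)
        (ih s (by omega) (by omega) fun r hr => hdense r ?_)
      rw [Finset.mem_Ioc] at hr ⊢
      omega
    · exact hE.window_subset_past hP e ⟨hE.monotone_view hP hbe hb, hrecent⟩

theorem past_subset_past (hE : E.Valid w honest elig) {P Q : Fin n} (hP : P ∈ honest)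
    (hQ : Q ∈ honest) {t₁ t₂ : ℕ} (h : t₁ ≤ t₂)
    (hdense : ∀ s ∈ Finset.Ioc t₁ t₂, ∃ v ∈ honest, elig (s, v) = true) :
    E.past w P t₁ ⊆ E.past w Q t₂ := by
  rw [hE.past_eq hP hQ]
  induction t₂, h using Nat.le_induction with
  | base => exact subset_rfl
  | succ t h ih =>
    obtain ⟨v, hv, hel⟩ := hdense (t + 1) (Finset.mem_Ioc.2 (by omega))
    exact (ih fun s hs => hdense s (Finset.Ioc_subset_Ioc_right t.le_succ hs)).trans
      (hE.past_subset_past_of_honest hQ hv hel le_rfl (by omega))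

theorem trimmedPast_subset_trimmedPast (hE : E.Valid w honest elig) (k : ℕ) {P Q : Fin n}
    (hP : P ∈ honest) (hQ : Q ∈ honest) {t₁ t₂ : ℕ} (h : t₁ ≤ t₂)
    (hdense : ∀ s ∈ Finset.Ioc t₁ t₂, ∃ v ∈ honest, elig (s, v) = true) :
    E.trimmedPast w k P t₁ ⊆ E.trimmedPast w k Q t₂ :=
  fun _ hb => ⟨hE.past_subset_past hP hQ h hdense hb.1, hb.2.trans h⟩

theorem honest_mem_tips (hE : E.Valid w honest elig) {P v : Fin n} (hP : P ∈ honest)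
    (hv : v ∈ honest) {s : ℕ} (hs : 1 ≤ s) (hel : elig (s, v) = true) :
    Block.mk s v ∈ E.tips w P s := by
  refine ⟨⟨hE.honest_mem_view hP hv hs le_rfl hel, Nat.le_add_right s w⟩, ?_⟩
  rintro ⟨d, hd, hbd⟩
  have hds : d.slot ≤ s := hE.slot_le hP hd.1
  have hsd : s + 1 ≤ d.slot := (Finset.mem_filter.1 hbd).2.1
  omega

theorem honest_mem_entering (hE : E.Valid w honest elig) {P v : Fin n} (hP : P ∈ honest)
    (hv : v ∈ honest) {s t ℓ : ℕ} (ht : 1 ≤ t) (hs : s ∈ Finset.Ico t (t + ℓ))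
    (hel : elig (s, v) = true) : Block.mk s v ∈ E.entering w P t ℓ := by
  rw [Finset.mem_Ico] at hs
  refine ⟨s, hs.1, hs.2, ?_, fun hearlier => ?_⟩
  · rw [hE.frontier_eq_tips]
    exact hE.honest_mem_tips hP hv (ht.trans hs.1) hel
  · have hslot : s ≤ s - 1 := hE.slot_le hP hearlier.1.1.1
    omega

end Valid

end Execution


/-! ### Counting blocks by coins -/

theorem Block.uncurry_mk_injective {n : ℕ} :
    Function.Injective (Function.uncurry (Block.mk (n := n))) :=
  Function.Injective2.uncurry fun _ _ _ _ => Block.mk.inj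

namespace Execution

variable {n : ℕ} {E : Execution n} {w : ℕ} {honest : Finset (Fin n)} {elig : ℕ × Fin n → Bool}

theorem trueCount_le_ncard {S : Finset (ℕ × Fin n)} {B : Set (Block n)} (hB : B.Finite)
    (h : ∀ s v, (s, v) ∈ S → elig (s, v) = true → Block.mk s v ∈ B) :
    trueCount S elig ≤ B.ncard := by
  rw [trueCount, ← Set.ncard_coe_finset,
    ← Set.ncard_image_of_injective _ Block.uncurry_mk_injective]
  refine Set.ncard_le_ncard ?_ hB
  rintro _ ⟨⟨s, v⟩, hi, rfl⟩
  have hi := Finset.mem_filter.1 (Finset.mem_coe.1 hi)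
  exact h s v hi.1 hi.2

theorem finite_grown (E : Execution n) (w : ℕ) (honest : Finset (Fin n)) (t ℓ : ℕ) :
    (E.grown w honest t ℓ).Finite := by
  refine ((Finset.Ico t (t + ℓ) ×ˢ honest).finite_toSet.image (Function.uncurry Block.mk)).subset ?_
  rintro (_ | ⟨s, v⟩) ⟨hhonest, hts, hst, -⟩
  · exact hhonest.elim
  · exact ⟨(s, v), Finset.mem_coe.2 (Finset.mem_product.2 ⟨Finset.mem_Ico.2 ⟨hts, hst⟩, hhonest⟩),
      rfl⟩

namespace Valid

theorem trueCount_le_ncard_grown (hE : E.Valid w honest elig) {t ℓ : ℕ} (ht : 1 ≤ t)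
    (hdense : ∀ r ∈ Finset.Ico t (t + ℓ), EligibleWithin elig honest r w) :
    trueCount (Finset.Ico t (t + ℓ) ×ˢ honest) elig ≤ (E.grown w honest t ℓ).ncard := by
  refine trueCount_le_ncard (finite_grown E w honest t ℓ) fun s v hi hel => ?_
  rw [Finset.mem_product, Finset.mem_Ico] at hi
  obtain ⟨⟨hts : t ≤ s, hst : s < t + ℓ⟩, hv : v ∈ honest⟩ := hi
  refine ⟨hv, hts, hst, v, hv, hE.mem_past_of_forall_eligibleWithin hv
    (hE.honest_mem_view hv hv (ht.trans hts) le_rfl hel) (Nat.le_sub_one_of_lt hst)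
    fun r hr => hdense r ?_⟩
  have hr : s < r ∧ r ≤ t + ℓ - 1 := Finset.mem_Ioc.1 hr
  rw [Finset.mem_Ico]
  omega

theorem entering_subset (hE : E.Valid w honest elig) {P : Fin n} (hP : P ∈ honest) (t ℓ : ℕ) :
    E.entering w P t ℓ ⊆ insert Block.genesis (Function.uncurry Block.mk ''
      ((Finset.Ico (t - w) (t + ℓ) ×ˢ Finset.univ).filter fun i => elig i = true)) := by
  rintro b ⟨s, hts, hst, hb, -⟩
  cases b with
  | genesis => exact Set.mem_insert _ _
  | mk r v =>
    obtain ⟨-, hrs, hel⟩ := hE.eligible P hP s r v hb.1.1.1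
    have hsr : s ≤ r + w := hb.1.1.2
    refine Set.mem_insert_of_mem _ ⟨(r, v), ?_, rfl⟩
    simp only [Finset.coe_filter, Set.mem_ofPred_eq, Finset.mem_product, Finset.mem_Ico,
      Finset.mem_univ, and_true]
    exact ⟨by omega, hel⟩

theorem finite_entering (hE : E.Valid w honest elig) {P : Fin n} (hP : P ∈ honest) (t ℓ : ℕ) :
    (E.entering w P t ℓ).Finite :=
  (((Finset.finite_toSet _).image _).insert _).subset (hE.entering_subset hP t ℓ)

theorem ncard_entering_le (hE : E.Valid w honest elig) {P : Fin n} (hP : P ∈ honest) (t ℓ : ℕ) :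
    (E.entering w P t ℓ).ncard ≤
      trueCount (Finset.Ico (t - w) (t + ℓ) ×ˢ Finset.univ) elig + 1 := by
  refine (Set.ncard_le_ncard (hE.entering_subset hP t ℓ)
    (((Finset.finite_toSet _).image _).insert _)).trans ((Set.ncard_insert_le _ _).trans ?_)
  rw [Set.ncard_image_of_injective _ Block.uncurry_mk_injective, Set.ncard_coe_finset, trueCount]

theorem trueCount_le_ncard_honest_entering (hE : E.Valid w honest elig) {P : Fin n}
    (hP : P ∈ honest) {t : ℕ} (ht : 1 ≤ t) (ℓ : ℕ) :
    trueCount (Finset.Ico t (t + ℓ) ×ˢ honest) elig ≤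
      {b ∈ E.entering w P t ℓ | b.IsHonest honest}.ncard := by
  refine trueCount_le_ncard ((hE.finite_entering hP t ℓ).subset fun _ h => h.1) fun s v hi hel => ?_
  obtain ⟨hs, hv⟩ := Finset.mem_product.1 hi
  exact ⟨hE.honest_mem_entering hP hv ht hs hel, hv⟩

end Valid

end Execution

/-! ### Non-asymptotic guarantees -/

/-- Whatever the adversary does and whatever the slot `t`, the property `good t` of the execution
fails with probability at most `δ`. This is the guarantee that `WithOverwhelmingProb` demands for a
single value of the security parameter, for an arbitrary set of honest validators. -/
def FailureProbLE {n : ℕ} (p : ℝ) (w : ℕ) (honest : Finset (Fin n))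
    (good : ℕ → Execution n → Prop) (δ : ℝ) : Prop :=
  ∀ (t : ℕ) (Ω : Type u) [MeasurableSpace Ω] (Pr : Measure Ω) [IsProbabilityMeasure Pr]
    (coin : ℕ × Fin n → Ω → Bool) (E : Ω → Execution n),
    PublicCoin Pr p coin →
    (∀ ω, (E ω).Valid w honest (fun i => coin i ω)) →
    Pr {ω | ¬ good t (E ω)} ≤ ENNReal.ofReal δ

section NonAsymptotic

variable {n : ℕ} {p : ℝ} {w : ℕ} {honest : Finset (Fin n)}

theorem failureProbLE_of_measureReal_le {good : ℕ → Execution n → Prop} {δ : ℝ}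
    (h : ∀ (t : ℕ) (Ω : Type u) [MeasurableSpace Ω] (Pr : Measure Ω) [IsProbabilityMeasure Pr]
      (coin : ℕ × Fin n → Ω → Bool) (E : Ω → Execution n),
      PublicCoin Pr p coin →
      (∀ ω, (E ω).Valid w honest (fun i => coin i ω)) →
      Pr.real {ω | ¬ good t (E ω)} ≤ δ) :
    FailureProbLE.{u} p w honest good δ := fun t Ω _ Pr _ coin E hc hE => by
  rw [← ofReal_measureReal]
  exact ENNReal.ofReal_le_ofReal (h t Ω Pr coin E hc hE)

theorem failureProbLE_of_one_le {good : ℕ → Execution n → Prop} {δ : ℝ} (hδ : 1 ≤ δ) :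
    FailureProbLE.{u} p w honest good δ :=
  failureProbLE_of_measureReal_le fun _ _ _ _ _ _ _ _ _ => measureReal_le_one.trans hδ

theorem FailureProbLE.mono {good good' : ℕ → Execution n → Prop} {δ : ℝ}
    (h : FailureProbLE.{u} p w honest good δ) (hgood : ∀ t E, good t E → good' t E) :
    FailureProbLE.{u} p w honest good' δ := fun t Ω _ Pr _ coin E hc hE =>
  (measure_mono <| Set.ofPred_subset_ofPred.2 fun ω => mt (hgood t (E ω))).trans
    (h t Ω Pr coin E hc hE)

theorem growth_failureProbLE (hp : 0 ≤ p) (w : ℕ) (honest : Finset (Fin n)) (ℓ : ℕ) :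
    FailureProbLE.{u} p w honest
      (fun t E => 1 ≤ t → ℓ * (p * honest.card) / 2 ≤ ((E.grown w honest t ℓ).ncard : ℝ))
      (ℓ * Real.exp (-(w * (p * honest.card) / 8)) +
        Real.exp (-(ℓ * (p * honest.card) / 8))) := by
  refine failureProbLE_of_measureReal_le fun t Ω _ Pr _ coin E hc hE => ?_
  have hgap := hc.measureReal_exists_not_eligibleWithin_le hp honest (Finset.Ico t (t + ℓ)) w
  have hfew := hc.measureReal_trueCount_Ico_le_half hp t ℓ honest
  rw [Nat.card_Ico, add_tsub_cancel_left] at hgap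
  refine (measureReal_mono (fun ω hfail => ?_)).trans
    ((measureReal_union_le _ _).trans (add_le_add hgap hfew))
  by_contra hgood
  simp only [Set.mem_union, Set.mem_ofPred_eq, not_or, not_exists, not_and, not_not,
    not_le] at hgood
  obtain ⟨hdense, hmany⟩ := hgood
  exact hfail fun ht =>
    hmany.le.trans (Nat.cast_le.2 ((hE ω).trueCount_le_ncard_grown ht hdense))

theorem commonPast_failureProbLE (hp : 0 ≤ p) (w : ℕ) (honest : Finset (Fin n)) (k T : ℕ) :
    FailureProbLE.{u} p w honest
      (fun t E => ∀ P ∈ honest, ∀ Q ∈ honest, ∀ t₁ t₂ : ℕ, t ≤ t₁ → t₁ ≤ t₂ → t₂ ≤ t + T →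
        E.trimmedPast w k P t₁ ⊆ E.trimmedPast w k Q t₂)
      (T * Real.exp (-(p * honest.card / 8))) := by
  refine failureProbLE_of_measureReal_le fun t Ω _ Pr _ coin E hc hE => ?_
  have hgap := hc.measureReal_exists_not_eligibleWithin_le hp honest (Finset.Ioc t (t + T)) 1
  rw [Nat.card_Ioc, add_tsub_cancel_left, Nat.cast_one, one_mul] at hgap
  refine (measureReal_mono (fun ω hfail => ?_)).trans hgap
  by_contra hgood
  simp only [Set.mem_ofPred_eq, not_exists, not_and, not_not] at hgood
  refine hfail fun P hP Q hQ t₁ t₂ ht₁ ht₁₂ ht₂ =>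
    (hE ω).trimmedPast_subset_trimmedPast k hP hQ ht₁₂ fun s hs => ?_
  obtain ⟨r, hr, hel⟩ := hgood s (Finset.Ioc_subset_Ioc ht₁ ht₂ hs)
  rw [Nat.Ico_succ_singleton, Finset.mem_singleton] at hr
  exact hr ▸ hel

/-- The fraction of honest blocks that DAG quality guarantees when the honest fraction of the
validators is `H` and the window has at most `C * ℓ` slots. -/
noncomputable def qualityFraction (C H : ℝ) : ℝ := H / (6 * (1 + C))

theorem qualityFraction_eq_mul (C H : ℝ) : qualityFraction C H = 1 / (6 * (1 + C)) * H :=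
  (one_div_mul_eq_div _ _).symm

theorem qualityFraction_nonneg {C H : ℝ} (hC : 0 ≤ C) (hH : 0 ≤ H) : 0 ≤ qualityFraction C H := by
  rw [qualityFraction]
  positivity

theorem qualityFraction_pos {C H : ℝ} (hC : 0 ≤ C) (hH : 0 < H) : 0 < qualityFraction C H := by
  rw [qualityFraction]
  positivity

theorem qualityFraction_le {C H : ℝ} (hC : 0 ≤ C) (hH : H ≤ 1) : qualityFraction C H ≤ 1 / 6 := by
  rw [qualityFraction, div_le_div_iff₀ (by positivity) (by norm_num)]
  linarith

theorem natCast_card_div_le_one (honest : Finset (Fin n)) : (honest.card : ℝ) / n ≤ 1 :=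
  div_le_one_of_le₀ (by exact_mod_cast card_finset_fin_le honest) (Nat.cast_nonneg _)

theorem expectedTrueCount_window_le {Ω : Type u} [MeasurableSpace Ω] {Pr : Measure Ω}
    {coin : ℕ × Fin n → Ω → Bool} (hc : PublicCoin Pr p coin) (hp : 0 ≤ p) {C : ℝ} {ℓ : ℕ}
    (hw : (w : ℝ) ≤ C * ℓ) (t : ℕ) :
    expectedTrueCount Pr coin (Finset.Ico (t - w) (t + ℓ) ×ˢ Finset.univ) ≤
      p * n * ((1 + C) * ℓ) := by
  have hslots : ((t + ℓ - (t - w) : ℕ) : ℝ) ≤ ℓ + w := by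
    exact_mod_cast (by omega : t + ℓ - (t - w) ≤ ℓ + w)
  rw [hc.expectedTrueCount_eq hp, Finset.card_product, Nat.card_Ico, Finset.card_fin, Nat.cast_mul]
  calc p * (((t + ℓ - (t - w) : ℕ) : ℝ) * n) = p * n * ((t + ℓ - (t - w) : ℕ) : ℝ) := by ring
    _ ≤ p * n * ((1 + C) * ℓ) := by
        gcongr
        linarith

theorem qualityFraction_mul_le {C : ℝ} (hC : 0 ≤ C) (P : Fin n) {ℓ : ℕ}
    (hrate : 1 ≤ ℓ * (p * honest.card)) {total : ℝ}
    (htotal : total ≤ 2 * (p * n * ((1 + C) * ℓ)) + 1) :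
    qualityFraction C (honest.card / n) * total ≤ ℓ * (p * honest.card) / 2 := by
  set μ := qualityFraction C (honest.card / n) with hμ
  have hn : (n : ℝ) ≠ 0 := Nat.cast_ne_zero.2 P.pos.ne'
  have hμ0 : 0 ≤ μ := qualityFraction_nonneg hC (by positivity)
  have hμ6 : μ ≤ 1 / 6 := qualityFraction_le hC (natCast_card_div_le_one honest)
  have hμrate : μ * (p * n * ((1 + C) * ℓ)) = ℓ * (p * honest.card) / 6 := by
    rw [hμ, qualityFraction]
    field_simp
  calc μ * total ≤ μ * (2 * (p * n * ((1 + C) * ℓ)) + 1) := by gcongr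
    _ = ℓ * (p * honest.card) / 3 + μ := by linear_combination 2 * hμrate
    _ ≤ ℓ * (p * honest.card) / 2 := by linarith

theorem quality_failureProbLE (hp : 0 ≤ p) {w : ℕ} (honest : Finset (Fin n)) {C : ℝ} {ℓ : ℕ}
    (hC : 0 ≤ C) (hw : (w : ℝ) ≤ C * ℓ) :
    FailureProbLE.{u} p w honest
      (fun t E => 1 ≤ t → ∀ P ∈ honest,
        qualityFraction C (honest.card / n) * ((E.entering w P t ℓ).ncard : ℝ) ≤
          (({b ∈ E.entering w P t ℓ | b.IsHonest honest}).ncard : ℝ))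
      (2 * Real.exp (-(ℓ * (p * honest.card) / 8))) := by
  rcases lt_or_ge (ℓ * (p * honest.card) : ℝ) 1 with hrate | hrate
  · exact failureProbLE_of_one_le (by
      linarith [Real.add_one_le_exp (-(ℓ * (p * honest.card) / 8))])
  refine failureProbLE_of_measureReal_le fun t Ω _ Pr _ coin E hc hE => ?_
  set M : ℝ := p * n * ((1 + C) * ℓ)
  have hfew := hc.measureReal_trueCount_Ico_le_half hp t ℓ honest
  have hmany := measureReal_two_mul_le_trueCount hc.measurable hc.indep _
    (expectedTrueCount_window_le hc hp hw t)
  have hrateM : ℓ * (p * honest.card) ≤ M := by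
    calc ℓ * (p * honest.card) ≤ ℓ * (p * n) := by
          gcongr
          exact card_finset_fin_le honest
      _ ≤ M := by
          have : 0 ≤ p * n * (C * ℓ) := by positivity
          linarith
  have hmany' : Real.exp (-(M / 4)) ≤ Real.exp (-(ℓ * (p * honest.card) / 8)) :=
    Real.exp_le_exp.2 (by linarith)
  rw [two_mul]
  refine (measureReal_mono (fun ω hfail => ?_)).trans
    ((measureReal_union_le _ _).trans (add_le_add hfew (hmany.trans hmany')))
  by_contra hgood
  simp only [Set.mem_union, Set.mem_ofPred_eq, not_or, not_le] at hgood
  obtain ⟨hhonest, htotal⟩ := hgood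
  refine hfail fun ht P hP => ?_
  have hentering : ((E ω).entering w P t ℓ).ncard ≤ 2 * M + 1 :=
    (Nat.cast_le.2 ((hE ω).ncard_entering_le hP t ℓ)).trans (by push_cast; linarith)
  calc qualityFraction C (honest.card / n) * (((E ω).entering w P t ℓ).ncard : ℝ)
      ≤ ℓ * (p * honest.card) / 2 := qualityFraction_mul_le hC P hrate hentering
    _ ≤ trueCount (Finset.Ico t (t + ℓ) ×ˢ honest) (coin · ω) := hhonest.le
    _ ≤ _ := Nat.cast_le.2 ((hE ω).trueCount_le_ncard_honest_entering hP ht ℓ)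

end NonAsymptotic

/-! ### Negligible functions -/

theorem SuperLog.negligible_exp {f : ℕ → ℝ} (hf : SuperLog f) (hf0 : ∀ κ, 0 ≤ f κ) {c : ℝ}
    (hc : 0 < c) : Negligible fun κ => Real.exp (-(f κ / c)) := by
  refine (superpolynomialDecay_iff_isBigO _ tendsto_natCast_atTop_atTop).2 fun z => ?_
  have hz : 0 < c * (|(z : ℝ)| + 1) := by positivity
  refine IsBigO.of_bound 1 ?_
  filter_upwards [hf.bound (inv_pos.2 hz), eventually_ge_atTop 1] with κ hκ hκ1
  have hκ0 : (0 : ℝ) < κ := by exact_mod_cast hκ1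
  have hlog : 0 ≤ Real.log κ := Real.log_nonneg (by exact_mod_cast hκ1)
  rw [Real.norm_of_nonneg hlog, Real.norm_of_nonneg (hf0 κ), le_inv_mul_iff₀ hz] at hκ
  have hexponent : (|(z : ℝ)| + 1) * Real.log κ ≤ f κ / c := by
    rw [le_div_iff₀ hc]
    linarith
  rw [one_mul, Real.norm_of_nonneg (Real.exp_nonneg _), Real.norm_of_nonneg (by positivity),
    ← Real.rpow_intCast, Real.rpow_def_of_pos hκ0, Real.exp_le_exp]
  nlinarith [neg_abs_le (z : ℝ)]

theorem Negligible.polyBounded_mul {ε : ℕ → ℝ} (hε : Negligible ε) {g : ℕ → ℕ}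
    (hg : PolyBounded g) : Negligible fun κ => g κ * ε κ := by
  obtain ⟨d, hd⟩ := hg
  obtain ⟨c, hc⟩ := hd.bound
  refine ((SuperpolynomialDecay.param_pow_mul hε d).const_mul c).trans_eventually_abs_le
    (hc.mono fun κ hκ => ?_)
  have hgκ : |(g κ : ℝ)| ≤ |c * (κ : ℝ) ^ d| :=
    hκ.trans ((le_abs_self _).trans_eq (by rw [abs_mul, abs_mul, Real.norm_eq_abs, abs_abs]))
  simpa only [Function.comp_apply, Pi.mul_apply, Pi.pow_apply, abs_mul, mul_assoc] using
    mul_le_mul_of_nonneg_right hgκ (abs_nonneg (ε κ))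

/-! ### Asymptotic guarantees -/

/-- `WithOverwhelmingProb` for an arbitrary sequence of honest validator sets instead of the honest
majorities that `Params` bundles. -/
def OverwhelminglyLikely {n : ℕ → ℕ} (p : ℕ → ℝ) (w : ℕ → ℕ) (honest : ∀ κ, Finset (Fin (n κ)))
    (good : (κ : ℕ) → ℕ → Execution (n κ) → Prop) : Prop :=
  ∃ ε : ℕ → ℝ, Negligible ε ∧ ∀ κ, FailureProbLE.{u} (p κ) (w κ) (honest κ) (good κ) (ε κ)

section Asymptotic

variable {n : ℕ → ℕ} {p : ℕ → ℝ} {w : ℕ → ℕ} {honest : ∀ κ, Finset (Fin (n κ))}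
  {good : (κ : ℕ) → ℕ → Execution (n κ) → Prop}

theorem OverwhelminglyLikely.mono {good' : (κ : ℕ) → ℕ → Execution (n κ) → Prop}
    (h : OverwhelminglyLikely.{u} p w honest good)
    (hgood : ∀ κ t E, good κ t E → good' κ t E) : OverwhelminglyLikely.{u} p w honest good' := by
  obtain ⟨ε, hε, hfail⟩ := h
  exact ⟨ε, hε, fun κ => (hfail κ).mono (hgood κ)⟩

theorem overwhelminglyLikely_of_eventually {ε : ℕ → ℝ} (hε : Negligible ε)
    (h : ∀ᶠ κ in atTop, FailureProbLE.{u} (p κ) (w κ) (honest κ) (good κ) (ε κ)) :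
    OverwhelminglyLikely.{u} p w honest good := by
  classical
  refine ⟨fun κ => if FailureProbLE.{u} (p κ) (w κ) (honest κ) (good κ) (ε κ) then ε κ else 1,
    hε.congr' (h.mono fun κ hκ => (if_pos hκ).symm), fun κ => ?_⟩
  dsimp only
  split_ifs with hκ
  · exact hκ
  · exact failureProbLE_of_one_le le_rfl

theorem overwhelminglyLikely_growth (hp : ∀ κ, 0 ≤ p κ) {ℓ : ℕ → ℕ}
    (hw : SuperLog fun κ => w κ * (p κ * (honest κ).card))
    (hℓ : SuperLog fun κ => ℓ κ * (p κ * (honest κ).card)) (hpoly : PolyBounded ℓ) :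
    OverwhelminglyLikely.{u} p w honest fun κ t E => 1 ≤ t →
      ℓ κ * (p κ * (honest κ).card) / 2 ≤ ((E.grown (w κ) (honest κ) t (ℓ κ)).ncard : ℝ) := by
  have hrate κ : 0 ≤ p κ * (honest κ).card := mul_nonneg (hp κ) (Nat.cast_nonneg _)
  have hgap := (hw.negligible_exp (fun κ => mul_nonneg (Nat.cast_nonneg _) (hrate κ))
    (c := 8) (by norm_num)).polyBounded_mul hpoly
  have hfew := hℓ.negligible_exp (fun κ => mul_nonneg (Nat.cast_nonneg _) (hrate κ))
    (c := 8) (by norm_num)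
  exact ⟨_, hgap.add hfew, fun κ => growth_failureProbLE (hp κ) (w κ) (honest κ) (ℓ κ)⟩

theorem overwhelminglyLikely_quality (hp : ∀ κ, 0 ≤ p κ) {C : ℝ} (hC : 0 ≤ C) {ℓ : ℕ → ℕ}
    (hℓ : SuperLog fun κ => ℓ κ * (p κ * (honest κ).card))
    (hw : ∀ᶠ κ in atTop, (w κ : ℝ) ≤ C * ℓ κ) :
    OverwhelminglyLikely.{u} p w honest fun κ t E => 1 ≤ t → ∀ P ∈ honest κ,
      qualityFraction C ((honest κ).card / n κ) * ((E.entering (w κ) P t (ℓ κ)).ncard : ℝ) ≤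
        (({b ∈ E.entering (w κ) P t (ℓ κ) | b.IsHonest (honest κ)}).ncard : ℝ) := by
  have hrate κ : 0 ≤ p κ * (honest κ).card := mul_nonneg (hp κ) (Nat.cast_nonneg _)
  have hfail := hℓ.negligible_exp (fun κ => mul_nonneg (Nat.cast_nonneg _) (hrate κ))
    (c := 8) (by norm_num)
  exact overwhelminglyLikely_of_eventually (SuperpolynomialDecay.const_mul hfail 2)
    (hw.mono fun κ hκ => quality_failureProbLE (hp κ) (honest κ) hC hκ)

theorem overwhelminglyLikely_commonPast (hp : ∀ κ, 0 ≤ p κ) (k : ℕ) {T : ℕ → ℕ}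
    (hrate : SuperLog fun κ => p κ * (honest κ).card) (hpoly : PolyBounded T) :
    OverwhelminglyLikely.{u} p w honest fun κ t E =>
      ∀ P ∈ honest κ, ∀ Q ∈ honest κ, ∀ t₁ t₂ : ℕ, t ≤ t₁ → t₁ ≤ t₂ → t₂ ≤ t + T κ →
        E.trimmedPast (w κ) k P t₁ ⊆ E.trimmedPast (w κ) k Q t₂ :=
  ⟨_, (hrate.negligible_exp (fun κ => mul_nonneg (hp κ) (Nat.cast_nonneg _))
    (c := 8) (by norm_num)).polyBounded_mul hpoly,
    fun κ => commonPast_failureProbLE (hp κ) (w κ) (honest κ) k (T κ)⟩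

end Asymptotic

theorem Params.growthRate_le (par : Params) (ℓ : ℕ) :
    par.p * par.H / 2 * ℓ ≤ ℓ * (par.p * par.honest.card) / 2 := by
  have hH : par.H ≤ par.honest.card := div_nat_le_self_of_nonnneg (Nat.cast_nonneg _) _
  have := mul_le_mul_of_nonneg_left hH (mul_nonneg par.p_pos.le ℓ.cast_nonneg)
  linarith

end AreonIdeal

open AreonIdeal in
theorem mainTheorem9_general {n : ℕ → ℕ} {p : ℕ → ℝ} (hp : ∀ κ, 0 ≤ p κ) (w : ℕ → ℕ)
    (honest : ∀ κ, Finset (Fin (n κ))) :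
    (∀ ℓ : ℕ → ℕ,
      SuperLog (fun κ => w κ * (p κ * (honest κ).card)) →
      SuperLog (fun κ => ℓ κ * (p κ * (honest κ).card)) →
      PolyBounded ℓ →
      OverwhelminglyLikely.{u} p w honest fun κ t E => 1 ≤ t →
        ℓ κ * (p κ * (honest κ).card) / 2 ≤ ((E.grown (w κ) (honest κ) t (ℓ κ)).ncard : ℝ)) ∧
    (∀ C : ℝ, 0 ≤ C → ∀ ℓ : ℕ → ℕ,
      SuperLog (fun κ => ℓ κ * (p κ * (honest κ).card)) →
      (∀ᶠ κ in atTop, (w κ : ℝ) ≤ C * ℓ κ) →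
      OverwhelminglyLikely.{u} p w honest fun κ t E => 1 ≤ t → ∀ P ∈ honest κ,
        qualityFraction C ((honest κ).card / n κ) * ((E.entering (w κ) P t (ℓ κ)).ncard : ℝ) ≤
          (({b ∈ E.entering (w κ) P t (ℓ κ) | b.IsHonest (honest κ)}).ncard : ℝ)) ∧
    (∀ (k : ℕ) (T : ℕ → ℕ),
      SuperLog (fun κ => p κ * (honest κ).card) →
      PolyBounded T →
      OverwhelminglyLikely.{u} p w honest fun κ t E =>
        ∀ P ∈ honest κ, ∀ Q ∈ honest κ, ∀ t₁ t₂ : ℕ, t ≤ t₁ → t₁ ≤ t₂ → t₂ ≤ t + T κ →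
          E.trimmedPast (w κ) k P t₁ ⊆ E.trimmedPast (w κ) k Q t₂) :=
  ⟨fun _ => overwhelminglyLikely_growth hp, fun _ hC _ => overwhelminglyLikely_quality hp hC,
    fun k _ => overwhelminglyLikely_commonPast hp k⟩

open AreonIdeal in
theorem mainTheorem9 :
    -- DAG growth with `τ = Θ(pH)`
    (∃ (τ : ℝ → ℝ → ℝ) (c₁ c₂ : ℝ), 0 < c₁ ∧ 0 < c₂ ∧
      (∀ p H : ℝ, 0 < p → p ≤ 1 → 1 / 2 < H → H ≤ 1 →
        0 < τ p H ∧ τ p H ≤ 1 ∧ c₁ * (p * H) ≤ τ p H ∧ τ p H ≤ c₂ * (p * H)) ∧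
      ∀ (par : ℕ → Params) (ℓ : ℕ → ℕ),
        SuperLog (fun κ => (par κ).w * (par κ).honestRate) →
        SuperLog (fun κ => ℓ κ * (par κ).honestRate) →
        PolyBounded ℓ →
        DAGGrowth.{u} par (fun κ => τ (par κ).p (par κ).H) ℓ) ∧
    -- DAG quality with `μ = Θ(H)`
    (∀ C : ℝ, ∃ (μ : ℝ → ℝ) (c₁ c₂ : ℝ), 0 < c₁ ∧ 0 < c₂ ∧
      (∀ H : ℝ, 1 / 2 < H → H ≤ 1 →
        0 < μ H ∧ μ H ≤ 1 ∧ c₁ * H ≤ μ H ∧ μ H ≤ c₂ * H) ∧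
      ∀ (par : ℕ → Params) (ℓ : ℕ → ℕ),
        SuperLog (fun κ => ℓ κ * (par κ).honestRate) →
        (∀ᶠ κ in Filter.atTop, ((par κ).w : ℝ) ≤ C * ℓ κ) →
        DAGQuality.{u} par (fun κ => μ (par κ).H) ℓ) ∧
    -- DAG common past with `k = O(1)`
    (∃ k : ℕ, ∀ (par : ℕ → Params) (T : ℕ → ℕ),
      SuperLog (fun κ => (par κ).honestRate) →
      PolyBounded T →
      DAGCommonPast.{u} par k T) := by
  have hgeneral (par : ℕ → Params) := mainTheorem9_general.{u} (fun κ => (par κ).p_pos.le)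
    (fun κ => (par κ).w) (fun κ => (par κ).honest)
  refine ⟨⟨fun p H => p * H / 2, 1 / 2, 1 / 2, one_half_pos, one_half_pos, ?_, ?_⟩,
    fun C => ⟨qualityFraction |C|, 1 / (6 * (1 + |C|)), 1 / (6 * (1 + |C|)), by positivity,
      by positivity, ?_, ?_⟩, 0, fun par => (hgeneral par).2.2 0⟩
  · intro p H hp hp1 hH hH1
    have hpH : p * H ≤ 1 := mul_le_one₀ hp1 (by linarith) hH1
    exact ⟨by positivity, by linarith, by linarith, by linarith⟩
  · intro par ℓ hw hℓ hpoly
    exact ((hgeneral par).1 ℓ hw hℓ hpoly).mono fun κ _ _ hgrown ht =>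
      ((par κ).growthRate_le (ℓ κ)).trans (hgrown ht)
  · intro H hH hH1
    exact ⟨qualityFraction_pos (abs_nonneg C) (by linarith),
      (qualityFraction_le (abs_nonneg C) hH1).trans (by norm_num),
      (qualityFraction_eq_mul _ _).ge, (qualityFraction_eq_mul _ _).le⟩
  · intro par ℓ hℓ hw
    exact (hgeneral par).2.1 |C| (abs_nonneg C) ℓ hℓ
      (hw.mono fun κ hκ => hκ.trans (by gcongr; exact le_abs_self C))
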